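/- Let $\mathbb F$ be a field of characteristic $p>0$, let $\mathfrak g$ be a restricted Lie algebra over $\mathbb F$ with $p$-operator $g\mapsto g^{[p]}$ (i.e. a Lie algebra with a map satisfying $(\lambda g)^{[p]}=\lambda^p g^{[p]}$, $[g,h^{[p]}]=[g,\underbrace{h,\dots,h}_p]$ and $(g+h)^{[p]}=g^{[p]}+h^{[p]}+\sum\frac1{\#(g)}[g_1,\dots,g_p]$, the sum being over all words $g_1,\dots,g_p\in\{g,h\}$ with $g_1=g$, $g_2=h$, where $\#(g)$ is the number of letters $g$), and let $M$ be a restricted $\mathfrak g$-module, i.e. a $\mathfrak g$-module with $g^{[p]}x=g^px$. Here $[x_1,\dots,x_n]=[[\cdots[[x_1,x_2],x_3],\cdots],x_n]$, with $[x_1]=x_1$. A pair $(\varphi,\omega)$, with $\varphi:\Lambda^2\mathfrak g\to M$ an alternating bilinear map and $\omega:\mathfrak g\to M$ a map, belongs to $C^2(\mathfrak g;M)$ if $\omega$ has the $*$-property with respect to $\varphi$: for all $\lambda\in\mathbb F$, $g,h\in\mathfrak g$, $\omega(\lambda g)=\lambda^p\omega(g)$ and $$\omega(g+h)=\omega(g)+\omega(h)+\sum_{\substack{g_j=g\text{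 or }h\\ g_1=g,\,g_2=h}}\frac1{\#(g)}\sum_{k=0}^{p-2}(-1)^k g_p\cdots g_{p-k+1}\,\varphi([g_1,\dots,g_{p-k-1}],g_{p-k}).$$ For an alternating trilinear map $\alpha:\Lambda^3\mathfrak g\to M$, a map $\beta:\mathfrak g\times\mathfrak g\to M$ has the $**$-property with respect to $\alpha$ if (i) $\beta(g,h)$ is linear in $g$; (ii) $\beta(g,\lambda h)=\lambda^p\beta(g,h)$ for $\lambda\in\mathbb F$; (iii) for all $g,h_1,h_2\in\mathfrak g$, $$\beta(g,h_1+h_2)=\beta(g,h_1)+\beta(g,h_2)-\sum_{\substack{l_1,\dots,l_p\in\{1,2\}\\ l_1=1,\,l_2=2}}\frac1{\#\{i:l_i=1\}}\sum_{j=0}^{p-2}(-1)^j\sum_{k=0}^{j}\binom jk\, h_{l_p}\cdots h_{l_{p-k+1}}\;\alpha\big([g,h_{l_{p-k}},\dots,h_{l_{p-j+1}}],\,[h_{l_1},\dots,h_{l_{p-j-1}}],\,h_{l_{p-j}}\big).$$ The space $C^3(\mathfrak g;M)$ consists of all pairs $(\alpha,\beta)$ with $\alpha:\Lambda^3\mathfrak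 g\to M$ alternating trilinear and $\beta$ having the $**$-property with respect to $\alpha$. **Lemma.** Let $(\varphi,\omega)\in C^2(\mathfrak g;M)$, let $$\delta_{\rm cl}\varphi(g,h,f)=\varphi([g,h],f)-\varphi([g,f],h)+\varphi([h,f],g)-g\varphi(h,f)+h\varphi(g,f)-f\varphi(g,h),$$ and define $\beta:\mathfrak g\times\mathfrak g\to M$ by $$\beta(g,h)=\varphi(g,h^{[p]})-\sum_{i+j=p-1}(-1)^i h^i\,\varphi([g,\underbrace{h,\dots,h}_j],h)+g\,\omega(h).$$ Then $\beta$ has the $**$-property with respect to $\delta_{\rm cl}\varphi$. Consequently $(\delta_{\rm cl}\varphi,\beta)\in C^3(\mathfrak g;M)$, i.e. $\delta^2:(\varphi,\omega)\mapsto(\delta_{\rm cl}\varphi,\beta)$ maps $C^2(\mathfrak g;M)$ to $C^3(\mathfrak g;M)$. -/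

import Mathlib

open LieModule.Cohomology

section Words

variable {L M : Type*} [LieRing L] [AddCommGroup M] [LieRingModule L M]

/-- The left-normed bracket `[x, y₁, …, yₙ] = [[⋯[[x, y₁], y₂], ⋯], yₙ]`, for a list
`ys = [y₁, …, yₙ]`. -/
def leftBracket (x : L) (ys : List L) : L :=
  ys.foldl (fun a y => ⁅a, y⁆) x

/-- The iterated action `y₁ (y₂ (⋯ (yₙ m)))`, for a list `ys = [y₁, …, yₙ]`. -/
def iterAct (ys : List L) (m : M) : M :=
  ys.foldr (fun y v => ⁅y, v⁆) m

/-- The left-normed bracket `[s 1, s 2, …, s n]` for `1 ≤ n`. -/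
def initialBracket (s : ℕ → L) (n : ℕ) : L :=
  leftBracket (s 1) ((List.range (n - 1)).map fun i => s (i + 2))

/-- The words `(l₁, …, l_p)` with letters `1` and `2`, with `l₁ = 1` and `l₂ = 2`. A word is
encoded by the set `S ⊆ {1, …, p}` of the positions `i` with `l_i = 1`; thus `#S` is the number
of letters `1` of the word. -/
def markedWords (p : ℕ) : Finset (Finset ℕ) :=
  (Finset.Icc 1 p).powerset.filter fun S => 1 ∈ S ∧ 2 ∉ S

/-- The sequence `i ↦ h_{l_i}` for the word encoded by `S`: it is `h₁` at the positions in `S`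
and `h₂` at the others. -/
def wordSeq (h₁ h₂ : L) (S : Finset ℕ) (i : ℕ) : L :=
  if i ∈ S then h₁ else h₂

end Words

/-- A restricted Lie algebra of characteristic `p`: a Lie algebra `L` over a field `F` with a
`p`-operator `g ↦ g^[p]`. -/
class RestrictedLieAlgebra (F : Type*) (p : ℕ) (L : Type*) [Field F] [LieRing L]
    [LieAlgebra F L] where
  /-- The `p`-operator `g ↦ g^[p]`. -/
  pOp : L → L
  pOp_smul : ∀ (c : F) (g : L), pOp (c • g) = c ^ p • pOp g
  pOp_add : ∀ g h : L, pOp (g + h) = pOp g + pOp h +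
    ∑ S ∈ markedWords p, ((S.card : F)⁻¹) • initialBracket (wordSeq g h S) p
  lie_pOp : ∀ g h : L, ⁅g, pOp h⁆ = leftBracket g (List.replicate p h)

/-- A module over a restricted Lie algebra is restricted if `g^[p]` acts as the `p`-th power of
`g`. -/
class IsRestrictedModule (F : Type*) (p : ℕ) (L M : Type*) [Field F] [LieRing L]
    [LieAlgebra F L] [RestrictedLieAlgebra F p L] [AddCommGroup M] [Module F M]
    [LieRingModule L M] [LieModule F L M] : Prop where
  pOp_act : ∀ (g : L) (m : M),
    ⁅RestrictedLieAlgebra.pOp F p g, m⁆ = (LieModule.toEnd F L M g ^ p) m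

section Cochains

variable (F : Type*) (p : ℕ) {L M : Type*} [Field F] [LieRing L] [LieAlgebra F L]
  [AddCommGroup M] [Module F M] [LieRingModule L M]

/-- The correction term
`∑ 1/#(g) ∑_{k=0}^{p-2} (-1)^k g_p ⋯ g_{p-k+1} φ([g_1, …, g_{p-k-1}], g_{p-k})`
of the `*`-property; the outer sum is over the words `g_1, …, g_p` in `g` and `h` with `g_1 = g`
and `g_2 = h`. -/
def starCorrection (φ : twoCochain F L M) (g h : L) : M :=
  ∑ S ∈ markedWords p, ((S.card : F)⁻¹) •
    ∑ k ∈ Finset.range (p - 1), (-1 : F) ^ k •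
      iterAct ((List.range k).map fun i => wordSeq g h S (p - i))
        (φ (initialBracket (wordSeq g h S) (p - k - 1)) (wordSeq g h S (p - k)))

/-- `ω` has the `*`-property with respect to `φ`. -/
structure HasStarProperty (φ : twoCochain F L M) (ω : L → M) : Prop where
  map_smul : ∀ (c : F) (g : L), ω (c • g) = c ^ p • ω g
  map_add : ∀ g h : L, ω (g + h) = ω g + ω h + starCorrection F p φ g h

/-- The term
`∑ 1/#{l_i = 1} ∑_{j=0}^{p-2} (-1)^j ∑_{k=0}^{j} (j choose k) h_{l_p} ⋯ h_{l_{p-k+1}}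
  α([g, h_{l_{p-k}}, …, h_{l_{p-j+1}}], [h_{l_1}, …, h_{l_{p-j-1}}], h_{l_{p-j}})`
that is subtracted in the `**`-property; the outer sum is over the words `l_1, …, l_p` in `1` and
`2` with `l_1 = 1` and `l_2 = 2`. -/
def starStarCorrection (α : L [⋀^Fin 3]→ₗ[F] M) (g h₁ h₂ : L) : M :=
  ∑ S ∈ markedWords p, ((S.card : F)⁻¹) •
    ∑ j ∈ Finset.range (p - 1), (-1 : F) ^ j •
      ∑ k ∈ Finset.range (j + 1), (j.choose k) •
        iterAct ((List.range k).map fun i => wordSeq h₁ h₂ S (p - i))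
          (α ![leftBracket g ((List.range (j - k)).map fun i => wordSeq h₁ h₂ S (p - k - i)),
            initialBracket (wordSeq h₁ h₂ S) (p - j - 1),
            wordSeq h₁ h₂ S (p - j)])

/-- `β` has the `**`-property with respect to `α`. -/
structure HasStarStarProperty (α : L [⋀^Fin 3]→ₗ[F] M) (β : L → L → M) : Prop where
  isLinearMap_left : ∀ h : L, IsLinearMap F fun g => β g h
  map_smul_right : ∀ (c : F) (g h : L), β g (c • h) = c ^ p • β g h
  map_add_right : ∀ g h₁ h₂ : L,
    β g (h₁ + h₂) = β g h₁ + β g h₂ - starStarCorrection F p α g h₁ h₂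

theorem iterAct_add (ys : List L) (m n : M) :
    iterAct ys (m + n) = iterAct ys m + iterAct ys n := by
  induction ys with
  | nil => rfl
  | cons y ys ih => simp only [iterAct, List.foldr_cons] at ih ⊢; rw [ih, lie_add]

theorem iterAct_zero (ys : List L) : iterAct ys (0 : M) = 0 := by
  induction ys with
  | nil => rfl
  | cons y ys ih => simp only [iterAct, List.foldr_cons] at ih ⊢; rw [ih, lie_zero]

theorem starCorrection_zero (g h : L) :
    starCorrection F p (0 : twoCochain F L M) g h = 0 := by
  have h0 : ∀ x y : L, (0 : twoCochain F L M) x y = 0 := fun _ _ => rfl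
  simp only [starCorrection, h0, iterAct_zero, smul_zero, Finset.sum_const_zero]

theorem starCorrection_add (φ ψ : twoCochain F L M) (g h : L) :
    starCorrection F p (φ + ψ) g h = starCorrection F p φ g h + starCorrection F p ψ g h := by
  simp only [starCorrection, add_apply_apply, iterAct_add, smul_add, Finset.sum_add_distrib]

theorem starStarCorrection_zero (g h₁ h₂ : L) :
    starStarCorrection F p (0 : L [⋀^Fin 3]→ₗ[F] M) g h₁ h₂ = 0 := by
  simp only [starStarCorrection, AlternatingMap.zero_apply, iterAct_zero, smul_zero,
    Finset.sum_const_zero]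

theorem starStarCorrection_add (α α' : L [⋀^Fin 3]→ₗ[F] M) (g h₁ h₂ : L) :
    starStarCorrection F p (α + α') g h₁ h₂ =
      starStarCorrection F p α g h₁ h₂ + starStarCorrection F p α' g h₁ h₂ := by
  simp only [starStarCorrection, AlternatingMap.add_apply, iterAct_add, smul_add,
    Finset.sum_add_distrib]

variable [LieModule F L M]

theorem iterAct_smul (c : F) (ys : List L) (m : M) :
    iterAct ys (c • m) = c • iterAct ys m := by
  induction ys with
  | nil => rfl
  | cons y ys ih => simp only [iterAct, List.foldr_cons] at ih ⊢; rw [ih, lie_smul]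

theorem starCorrection_smul (c : F) (φ : twoCochain F L M) (g h : L) :
    starCorrection F p (c • φ) g h = c • starCorrection F p φ g h := by
  simp only [starCorrection, smul_apply_apply, iterAct_smul, Finset.smul_sum, smul_comm c]

theorem starStarCorrection_smul (c : F) (α : L [⋀^Fin 3]→ₗ[F] M) (g h₁ h₂ : L) :
    starStarCorrection F p (c • α) g h₁ h₂ = c • starStarCorrection F p α g h₁ h₂ := by
  simp only [starStarCorrection, AlternatingMap.smul_apply, iterAct_smul, Finset.smul_sum,
    smul_comm c]

variable (L M)

/-- The space `C²(L; M)` of restricted 2-cochains. -/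
def restrictedTwoCochain : Submodule F (twoCochain F L M × (L → M)) where
  carrier := {c | HasStarProperty F p c.1 c.2}
  zero_mem' := ⟨fun _ _ => by simp, fun g h => by simp [starCorrection_zero]⟩
  add_mem' := by
    intro a b ha hb
    refine ⟨fun c g => ?_, fun g h => ?_⟩
    · simp [ha.map_smul, hb.map_smul]
    · simp only [Prod.fst_add, Prod.snd_add, Pi.add_apply, ha.map_add, hb.map_add,
        starCorrection_add]
      abel
  smul_mem' := by
    intro c a ha
    refine ⟨fun d g => ?_, fun g h => ?_⟩
    · simp [ha.map_smul, smul_comm c]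
    · simp only [Prod.smul_fst, Prod.smul_snd, Pi.smul_apply, ha.map_add, starCorrection_smul,
        smul_add]

/-- The space `C³(L; M)` of restricted 3-cochains. -/
def restrictedThreeCochain :
    Submodule F ((L [⋀^Fin 3]→ₗ[F] M) × (L → L → M)) where
  carrier := {c | HasStarStarProperty F p c.1 c.2}
  zero_mem' := ⟨fun _ => ⟨fun _ _ => by simp, fun _ _ => by simp⟩, fun _ _ _ => by simp,
    fun g h₁ h₂ => by simp [starStarCorrection_zero]⟩
  add_mem' := by
    intro a b ha hb
    refine ⟨fun h => ⟨fun x y => ?_, fun c x => ?_⟩, fun c g h => ?_, fun g h₁ h₂ => ?_⟩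
    · simp only [Prod.snd_add, Pi.add_apply, (ha.isLinearMap_left h).map_add,
        (hb.isLinearMap_left h).map_add]
      abel
    · simp only [Prod.snd_add, Pi.add_apply, (ha.isLinearMap_left h).map_smul,
        (hb.isLinearMap_left h).map_smul, smul_add]
    · simp [ha.map_smul_right, hb.map_smul_right]
    · simp only [Prod.fst_add, Prod.snd_add, Pi.add_apply, ha.map_add_right, hb.map_add_right,
        starStarCorrection_add]
      abel
  smul_mem' := by
    intro c a ha
    refine ⟨fun h => ⟨fun x y => ?_, fun d x => ?_⟩, fun d g h => ?_, fun g h₁ h₂ => ?_⟩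
    · simp only [Prod.smul_snd, Pi.smul_apply, (ha.isLinearMap_left h).map_add, smul_add]
    · simp only [Prod.smul_snd, Pi.smul_apply, (ha.isLinearMap_left h).map_smul, smul_comm c]
    · simp only [Prod.smul_snd, Pi.smul_apply, ha.map_smul_right, smul_comm c]
    · simp only [Prod.smul_fst, Prod.smul_snd, Pi.smul_apply, ha.map_add_right,
        starStarCorrection_smul, smul_add, smul_sub]

variable {L M}

/-- The classical (Chevalley-Eilenberg) coboundary `δ_cl φ` of a 2-cochain `φ`, an alternating
trilinear map:
`(δ_cl φ)(g, h, f) = φ([g,h], f) - φ([g,f], h) + φ([h,f], g)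
  - g φ(h, f) + h φ(g, f) - f φ(g, h)`.
This is the negative of Mathlib's `d₂₃`. -/
def classicalCoboundary (φ : twoCochain F L M) : L [⋀^Fin 3]→ₗ[F] M where
  toFun v := φ ⁅v 0, v 1⁆ (v 2) - φ ⁅v 0, v 2⁆ (v 1) + φ ⁅v 1, v 2⁆ (v 0)
    - ⁅v 0, φ (v 1) (v 2)⁆ + ⁅v 1, φ (v 0) (v 2)⁆ - ⁅v 2, φ (v 0) (v 1)⁆
  map_update_add' := by
    intro inst v i x y
    obtain rfl : inst = instDecidableEqFin 3 := Subsingleton.elim _ _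
    fin_cases i <;> simp [Function.update] <;> abel
  map_update_smul' := by
    intro inst v i c x
    obtain rfl : inst = instDecidableEqFin 3 := Subsingleton.elim _ _
    fin_cases i <;> simp [Function.update, smul_sub, smul_add]
  map_eq_zero_of_eq' := by
    intro v i j hv hij
    have key : ∀ x y z : L, φ ⁅x, y⁆ z = - φ ⁅y, x⁆ z := fun x y z => by
      rw [← lie_skew x y, map_neg, LinearMap.neg_apply]
    have hsymm : ∀ i j : Fin 3, i < j → v i = v j →
        φ ⁅v 0, v 1⁆ (v 2) - φ ⁅v 0, v 2⁆ (v 1) + φ ⁅v 1, v 2⁆ (v 0)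
          - ⁅v 0, φ (v 1) (v 2)⁆ + ⁅v 1, φ (v 0) (v 2)⁆ - ⁅v 2, φ (v 0) (v 1)⁆ = 0 := by
      intro i j hlt h
      fin_cases i <;> fin_cases j <;> simp only [Fin.zero_eta, Fin.mk_one, Fin.reduceFinMk] at h hlt
      all_goals first | exact absurd hlt (by decide) | skip
      · rw [h, lie_self, map_zero, LinearMap.zero_apply, twoCochain_alt, lie_zero]
        abel
      · rw [h, lie_self, map_zero, LinearMap.zero_apply, twoCochain_alt, lie_zero,
          key (v 1) (v 2), ← twoCochain_skew φ (v 2) (v 1), lie_neg]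
        abel
      · rw [h, lie_self, map_zero, LinearMap.zero_apply, twoCochain_alt, lie_zero]
        abel
    rcases lt_or_gt_of_ne hij with h | h
    · exact hsymm i j h hv
    · exact hsymm j i h hv.symm

theorem classicalCoboundary_apply (φ : twoCochain F L M) (g h f : L) :
    classicalCoboundary F φ ![g, h, f] = - d₂₃ F L M φ g h f := by
  simp only [classicalCoboundary, AlternatingMap.coe_mk, MultilinearMap.coe_mk,
    Matrix.cons_val_zero, Matrix.cons_val_one, Matrix.cons_val, d₂₃_apply]
  abel

/-- The map
`β(g, h) = φ(g, h^[p]) - ∑_{i+j=p-1} (-1)^i h^i φ([g, h, …, h], h) + g ω(h)`,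
with `j` letters `h` in the bracket, induced by a pair `(φ, ω)`. -/
def inducedMap [RestrictedLieAlgebra F p L] (φ : twoCochain F L M) (ω : L → M) (g h : L) : M :=
  φ g (RestrictedLieAlgebra.pOp F p h)
    - ∑ i ∈ Finset.range p, (-1 : F) ^ i •
        iterAct (List.replicate i h) (φ (leftBracket g (List.replicate (p - 1 - i) h)) h)
    + ⁅g, ω h⁆

end Cochains

/-! Fix `g`. The middle term of `β(g, h)` is the value at the constant word `h` of a map `q`
(`wordSum`), multilinear in `p` letters. The axioms for `h^[p]` and `ω` give the failure of
additivity of the other two terms as sums over words with weights `1/#S`. Hence the claim says that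
the failure of additivity of `q` is the same kind of sum, for one multilinear map `f`
(`wordDefect`).

Such a formula follows from a derivative (`map_add_of_polarDeriv_eq`). Suppose that the derivative
of `q` at `h` along `x` is `f(x, h, …, h)`. Put `h = t a + b`, `x = a` and compare coefficients of
`t`: the sum of `q` over words with `n` letters `a`, multiplied by `n`, is the sum of `f` over those
starting with `a`. For `0 < n < p` one divides by `n`. Words starting with `a a` drop out because
`f` vanishes when its first two letters agree.

The derivative identity (`sum_classicalCoboundary_add`) is algebra with three commuting operators on
bilinear maps `L × L → M`: `A` and `B` bracket an argument with `h`, and `H` acts by `h` on the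
value. The `**`-term is `T = ∑ (-1)^j (H+A)^j B^(p-2-j)` applied to `(u, v) ↦ δφ(u, v, h)`. This map
is `-(A+B+H)φ` plus three terms on which `A+B`, `H+A` or `H+B` acts simply. In characteristic `p`,
`T` can be rewritten to suit each of these terms (`commute_sum_identities`). -/

/-! ### Maps multilinear in the letters of a word -/

section MultilinearOn

variable (F : Type*) {V W : Type*} [Field F] [AddCommGroup V] [Module F V] [AddCommGroup W]
  [Module F W]

/-- A function of a sequence that depends only on the entries with index in `I`, and is linear
in each of them. -/
structure MultilinearOn (I : Finset ℕ) (f : (ℕ → V) → W) : Prop where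
  congr : ∀ s s' : ℕ → V, (∀ i ∈ I, s i = s' i) → f s = f s'
  map_update_add : ∀ i ∈ I, ∀ (s : ℕ → V) (x y : V),
    f (Function.update s i (x + y)) = f (Function.update s i x) + f (Function.update s i y)
  map_update_smul : ∀ i ∈ I, ∀ (s : ℕ → V) (c : F) (x : V),
    f (Function.update s i (c • x)) = c • f (Function.update s i x)

/-- The derivative at the constant sequence `h`, in the direction of `x`, of a function that is
multilinear in the entries with index in `I`. -/
def polarDeriv (I : Finset ℕ) (f : (ℕ → V) → W) (h x : V) : W :=
  ∑ i ∈ I, f (Function.update (fun _ => h) i x)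

namespace MultilinearOn

variable {F} {I J : Finset ℕ} {f f' : (ℕ → V) → W}

theorem map_update_of_notMem (hf : MultilinearOn F I f) {i : ℕ} (hi : i ∉ I) (s : ℕ → V) (x : V) :
    f (Function.update s i x) = f s :=
  hf.congr _ _ fun j hj => Function.update_of_ne (by rintro rfl; exact hi hj) _ _

theorem add (hf : MultilinearOn F I f) (hf' : MultilinearOn F I f') :
    MultilinearOn F I fun s => f s + f' s where
  congr s s' h := by rw [hf.congr s s' h, hf'.congr s s' h]
  map_update_add i hi s x y := by
    rw [hf.map_update_add i hi, hf'.map_update_add i hi]; abel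
  map_update_smul i hi s c x := by
    rw [hf.map_update_smul i hi, hf'.map_update_smul i hi, smul_add]

theorem const_smul (c : F) (hf : MultilinearOn F I f) : MultilinearOn F I fun s => c • f s where
  congr s s' h := by rw [hf.congr s s' h]
  map_update_add i hi s x y := by rw [hf.map_update_add i hi, smul_add]
  map_update_smul i hi s d x := by rw [hf.map_update_smul i hi, smul_comm]

theorem const_nsmul (n : ℕ) (hf : MultilinearOn F I f) : MultilinearOn F I fun s => n • f s := by
  simpa only [Nat.cast_smul_eq_nsmul] using hf.const_smul (n : F)

theorem sum {κ : Type*} (T : Finset κ) (g : κ → (ℕ → V) → W)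
    (hg : ∀ k ∈ T, MultilinearOn F I (g k)) : MultilinearOn F I fun s => ∑ k ∈ T, g k s where
  congr s s' h := Finset.sum_congr rfl fun k hk => (hg k hk).congr s s' h
  map_update_add i hi s x y := by
    rw [← Finset.sum_add_distrib]
    exact Finset.sum_congr rfl fun k hk => (hg k hk).map_update_add i hi s x y
  map_update_smul i hi s c x := by
    rw [Finset.smul_sum]
    exact Finset.sum_congr rfl fun k hk => (hg k hk).map_update_smul i hi s c x

theorem const (w : W) : MultilinearOn F ∅ fun _ : ℕ → V => w :=
  ⟨fun _ _ _ => rfl, by simp, by simp⟩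

theorem eval (n : ℕ) : MultilinearOn F {n} fun s : ℕ → V => s n :=
  ⟨fun s s' h => h n (by simp), by simp, by simp⟩

theorem linearMap {W' : Type*} [AddCommGroup W'] [Module F W'] (T : W →ₗ[F] W')
    (hf : MultilinearOn F I f) : MultilinearOn F I fun s => T (f s) where
  congr s s' h := by rw [hf.congr s s' h]
  map_update_add i hi s x y := by rw [hf.map_update_add i hi, map_add]
  map_update_smul i hi s c x := by rw [hf.map_update_smul i hi, map_smul]

theorem bilin {W₁ W₂ : Type*} [AddCommGroup W₁] [Module F W₁] [AddCommGroup W₂] [Module F W₂]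
    (B : W₁ →ₗ[F] W₂ →ₗ[F] W) {f₁ : (ℕ → V) → W₁} {f₂ : (ℕ → V) → W₂}
    (h₁ : MultilinearOn F I f₁) (h₂ : MultilinearOn F J f₂) (hIJ : Disjoint I J) :
    MultilinearOn F (I ∪ J) fun s => B (f₁ s) (f₂ s) where
  congr s s' h := by
    rw [h₁.congr s s' fun i hi => h i (Finset.mem_union_left _ hi),
      h₂.congr s s' fun i hi => h i (Finset.mem_union_right _ hi)]
  map_update_add i hi s x y := by
    rcases Finset.mem_union.1 hi with hi | hi
    · have hj := Finset.disjoint_left.1 hIJ hi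
      simp only [h₁.map_update_add i hi, h₂.map_update_of_notMem hj, map_add, LinearMap.add_apply]
    · have hj := Finset.disjoint_right.1 hIJ hi
      simp only [h₂.map_update_add i hi, h₁.map_update_of_notMem hj, map_add]
  map_update_smul i hi s c x := by
    rcases Finset.mem_union.1 hi with hi | hi
    · have hj := Finset.disjoint_left.1 hIJ hi
      simp only [h₁.map_update_smul i hi, h₂.map_update_of_notMem hj, map_smul,
        LinearMap.smul_apply]
    · have hj := Finset.disjoint_right.1 hIJ hi
      simp only [h₂.map_update_smul i hi, h₁.map_update_of_notMem hj, map_smul]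

theorem polarDeriv_bilin {W₁ W₂ : Type*} [AddCommGroup W₁] [Module F W₁] [AddCommGroup W₂]
    [Module F W₂] (B : W₁ →ₗ[F] W₂ →ₗ[F] W) {f₁ : (ℕ → V) → W₁} {f₂ : (ℕ → V) → W₂}
    (h₁ : MultilinearOn F I f₁) (h₂ : MultilinearOn F J f₂) (hIJ : Disjoint I J) (h x : V) :
    polarDeriv (I ∪ J) (fun s => B (f₁ s) (f₂ s)) h x =
      B (polarDeriv I f₁ h x) (f₂ fun _ => h) + B (f₁ fun _ => h) (polarDeriv J f₂ h x) := by
  rw [polarDeriv, Finset.sum_union hIJ, polarDeriv, polarDeriv, map_sum, map_sum,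
    LinearMap.sum_apply]
  congr 1
  · refine Finset.sum_congr rfl fun i hi => ?_
    rw [h₂.map_update_of_notMem (Finset.disjoint_left.1 hIJ hi)]
  · refine Finset.sum_congr rfl fun i hi => ?_
    rw [h₁.map_update_of_notMem (Finset.disjoint_right.1 hIJ hi)]

/-- Letters outside `I` stay arbitrary: the induction on `I` needs this, and it later allows one
letter to be frozen while the others are expanded. -/
theorem map_smul_add (hf : MultilinearOn F J f) (t : F) (a b : V) (hI : I ⊆ J) (s : ℕ → V) :
    f (fun n => if n ∈ I then t • a + b else s n) =
      ∑ S ∈ I.powerset, t ^ S.card •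
        f fun n => if n ∈ S then a else if n ∈ I then b else s n := by
  induction I using Finset.induction_on generalizing s with
  | empty => simp
  | insert i I hi ih =>
    have hiJ : i ∈ J := hI (Finset.mem_insert_self i I)
    have hIJ : I ⊆ J := (Finset.subset_insert i I).trans hI
    have e : ∀ c : V, (fun n => if n ∈ insert i I then c else s n) =
        Function.update (fun n => if n ∈ I then c else s n) i c := by
      intro c
      funext n
      by_cases hn : n = i
      · subst hn; simp
      · simp [hn]
    have e' : ∀ c d : V, Function.update (fun n => if n ∈ I then c else s n) i d =
        fun n => if n ∈ I then c else Function.update s i d n := by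
      intro c d
      funext n
      by_cases hn : n = i
      · subst hn; simp [hi]
      · simp [hn]
    rw [e, hf.map_update_add i hiJ, hf.map_update_smul i hiJ, e', e', ih hIJ, ih hIJ,
      Finset.sum_powerset_insert hi, add_comm, Finset.smul_sum]
    congr 1
    · refine Finset.sum_congr rfl fun S hS => ?_
      congr 2
      funext n
      by_cases hn : n = i
      · subst hn; simp [hi]
      · simp [hn]
    · refine Finset.sum_congr rfl fun S hS => ?_
      have hiS : i ∉ S := fun h => hi (Finset.mem_powerset.1 hS h)
      rw [Finset.card_insert_of_notMem hiS, pow_succ', smul_smul]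
      congr 2
      funext n
      by_cases hn : n = i
      · subst hn; simp [hi, hiS]
      · simp [hn]

end MultilinearOn

/-- Linear functionals reduce this to a scalar polynomial of degree at most `p - 1`, which vanishes
at the `p` distinct elements `0, …, p - 1` of `F`. The bound is sharp enough even for `F` with `p`
elements. -/
theorem eq_zero_of_sum_pow_smul_eq_zero (p : ℕ) [Fact p.Prime] [CharP F p] (a : ℕ → W)
    (h : ∀ t : F, ∑ i ∈ Finset.range p, t ^ i • a i = 0) {i : ℕ} (hi : i < p) : a i = 0 := by
  refine (Module.forall_dual_apply_eq_zero_iff F (a i)).1 fun ξ => ?_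
  set P : Polynomial F := ∑ j ∈ Finset.range p, Polynomial.monomial j (ξ (a j)) with hP
  have hdeg : P.natDegree < Fintype.card (Fin p) := by
    rw [Fintype.card_fin, hP]
    have hp : 0 < p := (Fact.out : p.Prime).pos
    refine lt_of_le_of_lt (Polynomial.natDegree_sum_le_of_forall_le (n := p - 1) _ _
      fun j hj => (Polynomial.natDegree_monomial_le _).trans ?_) (Nat.sub_lt hp one_pos)
    have := Finset.mem_range.1 hj
    omega
  have hinj : Function.Injective fun n : Fin p => ((n : ℕ) : F) := fun m n hmn =>
    Fin.ext (CharP.natCast_injOn_Iio F p m.2 n.2 hmn)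
  have h0 : P = 0 := by
    refine Polynomial.eq_zero_of_natDegree_lt_card_of_eval_eq_zero P hinj (fun n => ?_) hdeg
    have := congrArg ξ (h n)
    simpa [hP, Polynomial.eval_finsetSum, mul_comm] using this
  have := congrArg (fun Q => Polynomial.coeff Q i) h0
  simpa [hP, Polynomial.finsetSum_coeff, Polynomial.coeff_monomial, hi] using this

end MultilinearOn

/-! ### Polarization: from a derivative to the failure of additivity -/

section Polarization

variable {F : Type*} {L M : Type*} [Field F] [LieRing L] [LieAlgebra F L]
  [AddCommGroup M] [Module F M]

theorem MultilinearOn.map_smul_add_const {I : Finset ℕ} {f : (ℕ → L) → M}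
    (hf : MultilinearOn F I f) (t : F) (a b : L) :
    f (fun _ => t • a + b) = ∑ S ∈ I.powerset, t ^ S.card • f (wordSeq a b S) := by
  have h := hf.map_smul_add t a b subset_rfl fun _ => b
  rw [hf.congr (fun _ => t • a + b) (fun n => if n ∈ I then t • a + b else b)
    fun i hi => by simp [hi], h]
  refine Finset.sum_congr rfl fun S _ => ?_
  congr 2
  funext n
  simp [wordSeq]

/-- The letter at `i` is `a` without its factor `t`, so only sets containing `i` occur and the
exponent falls by one. -/
theorem MultilinearOn.map_update_smul_add_const {I : Finset ℕ} {f : (ℕ → L) → M}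
    (hf : MultilinearOn F I f) (t : F) (a b : L) {i : ℕ} (hi : i ∈ I) :
    f (Function.update (fun _ => t • a + b) i a) =
      ∑ S ∈ I.powerset with i ∈ S, t ^ (S.card - 1) • f (wordSeq a b S) := by
  have h := hf.map_smul_add t a b (Finset.erase_subset i I) fun _ => a
  rw [hf.congr (Function.update (fun _ => t • a + b) i a)
    (fun n => if n ∈ I.erase i then t • a + b else a), h]
  · refine Finset.sum_bij (fun S _ => insert i S) ?_ ?_ ?_ ?_
    · intro S hS
      simp only [Finset.mem_powerset, Finset.mem_filter, Finset.mem_insert_self, and_true] at hS ⊢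
      exact Finset.insert_subset hi (hS.trans (Finset.erase_subset _ _))
    · intro S hS T hT hST
      have hiS : i ∉ S := fun h => Finset.notMem_erase i I (Finset.mem_powerset.1 hS h)
      have hiT : i ∉ T := fun h => Finset.notMem_erase i I (Finset.mem_powerset.1 hT h)
      rw [← Finset.erase_insert hiS, hST, Finset.erase_insert hiT]
    · intro S hS
      obtain ⟨hS, hiS⟩ := Finset.mem_filter.1 hS
      exact ⟨S.erase i, Finset.mem_powerset.2 (Finset.erase_subset_erase i
        (Finset.mem_powerset.1 hS)), Finset.insert_erase hiS⟩
    · intro S hS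
      have hiS : i ∉ S := fun h => Finset.notMem_erase i I (Finset.mem_powerset.1 hS h)
      rw [Finset.card_insert_of_notMem hiS, Nat.add_sub_cancel]
      congr 1
      refine hf.congr _ _ fun n hn => ?_
      by_cases hni : n = i
      · subst hni; simp [wordSeq]
      · simp [wordSeq, hni, hn]
  · intro n hn
    by_cases hni : n = i
    · subst hni; simp
    · simp [hni, hn]

/-- This is `d/dt` of `q(t a + b)`: the word of `S` arises once for each differentiated position in
`S`, whence the factor `#S`. -/
theorem polarDeriv_smul_add {I : Finset ℕ} {f : (ℕ → L) → M}
    (hf : MultilinearOn F I f) (t : F) (a b : L) :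
    polarDeriv I f (t • a + b) a =
      ∑ S ∈ I.powerset, (S.card : F) • t ^ (S.card - 1) • f (wordSeq a b S) := by
  rw [polarDeriv, Finset.sum_congr rfl fun i hi => hf.map_update_smul_add_const t a b hi]
  simp only [Finset.sum_filter]
  rw [Finset.sum_comm]
  refine Finset.sum_congr rfl fun S hS => ?_
  rw [← Finset.sum_filter, Finset.sum_const, Nat.cast_smul_eq_nsmul,
    Finset.filter_mem_eq_inter, Finset.inter_eq_right.2 (Finset.mem_powerset.1 hS)]

variable (F) in
/-- If the derivative of a homogeneous map `q` of degree `p`, at `h` in the direction of `x`, is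
`f (x, h, …, h)`, then the deviation of `q` from additivity is the weighted sum of the values of
`f` over the words. -/
theorem map_add_of_polarDeriv_eq (p : ℕ) [Fact p.Prime] [CharP F p] {f q : (ℕ → L) → M}
    (hf : MultilinearOn F (Finset.Icc 1 p) f) (hq : MultilinearOn F (Finset.Icc 1 p) q)
    (hfq : ∀ h x : L, f (Function.update (fun _ => h) 1 x) = polarDeriv (Finset.Icc 1 p) q h x)
    (hf0 : ∀ s, s 1 = s 2 → f s = 0) (a b : L) :
    q (fun _ => a + b) = q (fun _ => a) + q (fun _ => b) +
      ∑ S ∈ markedWords p, (S.card : F)⁻¹ • f (wordSeq a b S) := by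
  have hp := (Fact.out : p.Prime)
  have hmem : 1 ∈ Finset.Icc 1 p := Finset.mem_Icc.2 ⟨le_rfl, hp.one_lt.le⟩
  set I := Finset.Icc 1 p with hI
  have hcard : I.card = p := by simp [hI]
  set A : ℕ → M := fun i => ∑ S ∈ I.powersetCard i, q (wordSeq a b S) with hA
  set B : ℕ → M := fun i => ∑ S ∈ I.powersetCard i, if 1 ∈ S then f (wordSeq a b S) else 0 with hB
  have hB0 : B 0 = 0 := by simp [hB]
  -- Both sides are the coefficient of `t^i` in the derivative hypothesis at `h = t a + b`, `x = a`.
  -- There are only `p` such coefficients.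
  have key : ∀ i < p, B (i + 1) = ((i + 1 : ℕ) : F) • A (i + 1) := by
    intro i hi
    rw [← sub_eq_zero]
    refine eq_zero_of_sum_pow_smul_eq_zero F p
      (fun i => B (i + 1) - ((i + 1 : ℕ) : F) • A (i + 1)) (fun t => ?_) hi
    have h := hfq (t • a + b) a
    rw [hf.map_update_smul_add_const t a b hmem, polarDeriv_smul_add hq, Finset.sum_filter,
      Finset.sum_powerset, Finset.sum_powerset, hcard, Finset.sum_range_succ',
      Finset.sum_range_succ' _ p] at h
    simp only [smul_sub, Finset.sum_sub_distrib]
    rw [sub_eq_zero]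
    simp only [Finset.powersetCard_zero, Finset.sum_singleton, Finset.notMem_empty, if_false,
      Finset.card_empty, Nat.cast_zero, zero_smul, add_zero] at h
    convert h using 2 with j _ j _
    · simp only [hB]
      rw [Finset.smul_sum]
      refine Finset.sum_congr rfl fun S hS => ?_
      rw [(Finset.mem_powersetCard.1 hS).2]
      split_ifs <;> simp
    · simp only [hA]
      rw [Finset.smul_sum, Finset.smul_sum]
      refine Finset.sum_congr rfl fun S hS => ?_
      rw [(Finset.mem_powersetCard.1 hS).2, smul_comm]
      simp
  have hsum : ∑ S ∈ markedWords p, (S.card : F)⁻¹ • f (wordSeq a b S) =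
      ∑ i ∈ Finset.range (p + 1), (i : F)⁻¹ • B i := by
    have h1 : ∑ S ∈ markedWords p, (S.card : F)⁻¹ • f (wordSeq a b S) =
        ∑ S ∈ I.powerset, (S.card : F)⁻¹ • if 1 ∈ S then f (wordSeq a b S) else 0 := by
      rw [markedWords, Finset.sum_filter]
      refine Finset.sum_congr rfl fun S _ => ?_
      by_cases h1 : 1 ∈ S <;> by_cases h2 : 2 ∈ S <;> simp [h1, h2]
      -- The condition `2 ∉ S` in `markedWords` costs nothing: words with equal first two letters
      -- contribute zero.
      rw [hf0 _ (by simp [wordSeq, h1, h2]), smul_zero]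
    rw [h1, Finset.sum_powerset, hcard]
    refine Finset.sum_congr rfl fun i _ => ?_
    rw [hB, Finset.smul_sum]
    refine Finset.sum_congr rfl fun S hS => ?_
    rw [(Finset.mem_powersetCard.1 hS).2]
  have hqa : A p = q fun _ => a := by
    rw [hA]
    simp only
    rw [← hcard, Finset.powersetCard_self, Finset.sum_singleton]
    exact hq.congr _ _ fun i hi => by simp [wordSeq, hi]
  have hqb : A 0 = q fun _ => b := by
    rw [hA]
    simp only [Finset.powersetCard_zero, Finset.sum_singleton]
    exact hq.congr _ _ fun i hi => by simp [wordSeq]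
  have hexp := hq.map_smul_add_const 1 a b
  simp only [one_smul, one_pow] at hexp
  rw [hexp, hsum, Finset.sum_powerset, hcard, ← hqa, ← hqb]
  change ∑ i ∈ Finset.range (p + 1), A i = _
  rw [Finset.sum_range_succ, Finset.sum_range_succ (fun i => (i : F)⁻¹ • B i)]
  obtain ⟨m, rfl⟩ : ∃ m, p = m + 1 := ⟨p - 1, by have := hp.pos; omega⟩
  -- The two extreme terms of the weighted sum vanish: `B 0 = 0`, and the weight at `p` is `(p :
  -- F)⁻¹ = 0⁻¹ = 0`.
  rw [Finset.sum_range_succ', Finset.sum_range_succ', hB0, CharP.cast_eq_zero F (m + 1), inv_zero,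
    zero_smul, smul_zero]
  have : ∑ i ∈ Finset.range m, ((i + 1 : ℕ) : F)⁻¹ • B (i + 1) =
      ∑ i ∈ Finset.range m, A (i + 1) := by
    refine Finset.sum_congr rfl fun i hi => ?_
    have him := Finset.mem_range.1 hi
    have hne : ((i + 1 : ℕ) : F) ≠ 0 := by
      rw [Ne, CharP.cast_eq_zero_iff F (m + 1)]
      exact fun hd => absurd (Nat.le_of_dvd (Nat.succ_pos i) hd) (by omega)
    rw [key i (by omega), inv_smul_smul₀ hne]
  rw [this]
  abel

end Polarization

/-! ### Polynomial identities in characteristic `p` -/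

section CommutingOperators

/-- In characteristic `p` the geometric sum of `-x` and `y` is `(x + y) ^ (p - 1)`. -/
theorem sum_neg_one_pow_mul_pow_mul_pow {R : Type*} [CommRing R] [IsDomain R] (p : ℕ)
    [Fact p.Prime] [CharP R p] (x y : R) (hxy : x + y ≠ 0) :
    ∑ i ∈ Finset.range p, (-1) ^ i * x ^ i * y ^ (p - 1 - i) = (x + y) ^ (p - 1) := by
  have h := geom_sum₂_mul (-x) y p
  have h2 : (x + y) ^ (p - 1) * (x + y) = x ^ p + y ^ p := by
    rw [← pow_succ, Nat.sub_add_cancel (Fact.out : p.Prime).pos, add_pow_char]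
  -- Obtained from Frobenius additivity rather than parity, so that `p = 2` is covered.
  have h3 : (-x) ^ p = - x ^ p := by
    have := add_pow_char (-x) x p
    rw [neg_add_cancel, zero_pow (Fact.out : p.Prime).ne_zero] at this
    linear_combination -this
  refine mul_right_cancel₀ hxy ?_
  rw [h2]
  simp only [neg_pow x] at h h3
  linear_combination (-1 : R) * h - h3

/-- A geometric sum in `-(H + A)` and `B`; `(-1)^(p-1) = 1` holds for `p = 2` as well, because `-1 =
1` there. -/
theorem sum_neg_one_pow_mul_add_pow_mul {R : Type*} [CommRing R] [IsDomain R] (p : ℕ)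
    [Fact p.Prime] [CharP R p] (A B H : R) :
    (∑ j ∈ Finset.range (p - 1), (-1) ^ j * (H + A) ^ j * B ^ (p - 2 - j)) * (A + B + H) =
      B ^ (p - 1) - (H + A) ^ (p - 1) := by
  have h := geom_sum₂_mul (-(H + A)) B (p - 1)
  have h1 : (-1 : R) ^ (p - 1) = 1 := by
    rcases (Fact.out : p.Prime).eq_two_or_odd' with rfl | ho
    · have : (2 : R) = 0 := CharP.cast_eq_zero R 2
      norm_num
      linear_combination -this
    · exact (Nat.Odd.sub_odd ho odd_one).neg_one_pow
  simp only [neg_pow (H + A)] at h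
  rw [h1, Nat.sub_sub] at h
  linear_combination (-1 : R) * h

section Domain

variable {R : Type*} [CommRing R] [IsDomain R] (p : ℕ) [Fact p.Prime] [CharP R p] (A B H : R)

/-- After multiplication by `A + B + H`, Frobenius reduces both sides to the previous identity. -/
theorem sum_neg_one_pow_mul_add_pow_mul_mul (hABH : A + B + H ≠ 0) :
    (∑ j ∈ Finset.range (p - 1), (-1) ^ j * (H + A) ^ j * B ^ (p - 2 - j)) * B =
      (A + B + H) ^ (p - 1) - (H + A) ^ (p - 1) := by
  have h := sum_neg_one_pow_mul_add_pow_mul p A B H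
  have hp : p - 1 + 1 = p := Nat.sub_add_cancel (Fact.out : p.Prime).pos
  have h1 : (A + B + H) ^ (p - 1) * (A + B + H) = B ^ p + (H + A) ^ p := by
    rw [← pow_succ, hp, ← add_pow_char]; ring
  have h2 : (H + A) ^ (p - 1) * (H + A) = (H + A) ^ p := by rw [← pow_succ, hp]
  have h3 : B ^ (p - 1) * B = B ^ p := by rw [← pow_succ, hp]
  refine mul_right_cancel₀ hABH ?_
  linear_combination B * h - h1 + h2 + h3

/-- Multiplying by `B = (A + B) - A` telescopes each inner sum; the two remaining alternating sums
are the `(p-1)`-st powers of `A + B + H` and `H + A`. -/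
theorem sum_eq_sum_mul_geom_sum (hB : B ≠ 0) (hHA : H + A ≠ 0) (hABH : A + B + H ≠ 0) :
    ∑ j ∈ Finset.range (p - 1), (-1) ^ j * (H + A) ^ j * B ^ (p - 2 - j) =
      ∑ i ∈ Finset.range p, (-1) ^ i * H ^ i *
        ∑ c ∈ Finset.range (p - 1 - i), (A + B) ^ (p - 2 - i - c) * A ^ c := by
  refine mul_right_cancel₀ hB ?_
  rw [sum_neg_one_pow_mul_add_pow_mul_mul p A B H hABH, Finset.sum_mul]
  have e : ∀ i ∈ Finset.range p, (-1) ^ i * H ^ i *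
      (∑ c ∈ Finset.range (p - 1 - i), (A + B) ^ (p - 2 - i - c) * A ^ c) * B =
      (-1) ^ i * H ^ i * (A + B) ^ (p - 1 - i) - (-1) ^ i * H ^ i * A ^ (p - 1 - i) := by
    intro i _
    have h := geom_sum₂_mul A (A + B) (p - 1 - i)
    rw [show p - 1 - i - 1 = p - 2 - i by omega] at h
    simp only [mul_comm (A ^ _)] at h
    linear_combination (-1 : R) * (-1) ^ i * H ^ i * h
  rw [Finset.sum_congr rfl e, Finset.sum_sub_distrib,
    sum_neg_one_pow_mul_pow_mul_pow p H A hHA,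
    sum_neg_one_pow_mul_pow_mul_pow p H (A + B) (by rwa [add_comm])]
  ring

/-- The same argument with `B = (H + B) - H`. -/
theorem sum_eq_sum_geom_sum_mul (hB : B ≠ 0) (hHA : H + A ≠ 0) (hABH : A + B + H ≠ 0) :
    ∑ j ∈ Finset.range (p - 1), (-1) ^ j * (H + A) ^ j * B ^ (p - 2 - j) =
      ∑ i ∈ Finset.range p, (-1) ^ i *
        (∑ a ∈ Finset.range i, H ^ a * (H + B) ^ (i - 1 - a)) * A ^ (p - 1 - i) := by
  refine mul_right_cancel₀ hB ?_
  rw [sum_neg_one_pow_mul_add_pow_mul_mul p A B H hABH, Finset.sum_mul]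
  have e : ∀ i ∈ Finset.range p, (-1) ^ i *
      (∑ a ∈ Finset.range i, H ^ a * (H + B) ^ (i - 1 - a)) * A ^ (p - 1 - i) * B =
      (-1) ^ i * (H + B) ^ i * A ^ (p - 1 - i) - (-1) ^ i * H ^ i * A ^ (p - 1 - i) := by
    intro i _
    have h := geom_sum₂_mul H (H + B) i
    linear_combination (-1 : R) * (-1) ^ i * A ^ (p - 1 - i) * h
  rw [Finset.sum_congr rfl e, Finset.sum_sub_distrib,
    sum_neg_one_pow_mul_pow_mul_pow p H A hHA,
    sum_neg_one_pow_mul_pow_mul_pow p (H + B) A (by rwa [add_comm, ← add_assoc, add_right_comm])]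
  ring

end Domain

theorem exists_algHom_of_commute {F E : Type*} [Field F] [Ring E] [Algebra F E] {A B H : E}
    (hAB : Commute A B) (hAH : Commute A H) (hBH : Commute B H) :
    ∃ χ : MvPolynomial (Fin 3) F →ₐ[F] E,
      χ (MvPolynomial.X 0) = A ∧ χ (MvPolynomial.X 1) = B ∧ χ (MvPolynomial.X 2) = H := by
  have hcomm : ∀ a ∈ ({A, B, H} : Set E), ∀ b ∈ ({A, B, H} : Set E), a * b = b * a := by
    rintro a (rfl | rfl | rfl) b (rfl | rfl | rfl)
    exacts [rfl, hAB, hAH, hAB.symm, rfl, hBH, hAH.symm, hBH.symm, rfl]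
  have := Algebra.isMulCommutative_adjoin F hcomm
  let _ : CommRing (Algebra.adjoin F ({A, B, H} : Set E)) :=
    { Subalgebra.toRing _ with mul_comm := this.is_comm.comm }
  let v : Fin 3 → Algebra.adjoin F ({A, B, H} : Set E) :=
    ![⟨A, Algebra.subset_adjoin (by simp)⟩, ⟨B, Algebra.subset_adjoin (by simp)⟩,
      ⟨H, Algebra.subset_adjoin (by simp)⟩]
  exact ⟨(Algebra.adjoin F ({A, B, H} : Set E)).val.comp (MvPolynomial.aeval v),
    by simp [v], by simp [v], by simp [v]⟩

/-- The cancellations need a domain, so the identities are proved in a polynomial ring and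
specialized. Factors are ordered for application to a bilinear map: the rightmost factor, `A + B` or
`H + B`, acts first, on a map where it has a closed form. -/
theorem commute_sum_identities {E : Type*} (F : Type*) [Field F] [Ring E] [Algebra F E] (p : ℕ)
    [Fact p.Prime] [CharP F p] {A B H : E} (hAB : Commute A B) (hAH : Commute A H)
    (hBH : Commute B H) :
    (∑ j ∈ Finset.range (p - 1), (-1) ^ j * (H + A) ^ j * B ^ (p - 2 - j)) * (A + B + H) =
        B ^ (p - 1) - ∑ i ∈ Finset.range p, (-1) ^ i * H ^ i * A ^ (p - 1 - i) ∧
      ∑ j ∈ Finset.range (p - 1), (-1) ^ j * (H + A) ^ j * B ^ (p - 2 - j) =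
        ∑ i ∈ Finset.range p, (-1) ^ i * H ^ i *
          ∑ c ∈ Finset.range (p - 1 - i), A ^ c * (A + B) ^ (p - 2 - i - c) ∧
      ∑ j ∈ Finset.range (p - 1), (-1) ^ j * (H + A) ^ j * B ^ (p - 2 - j) =
        ∑ i ∈ Finset.range p, (-1) ^ i *
          A ^ (p - 1 - i) * ∑ a ∈ Finset.range i, H ^ a * (H + B) ^ (i - 1 - a) := by
  obtain ⟨χ, rfl, rfl, rfl⟩ := exists_algHom_of_commute (F := F) hAB hAH hBH
  set X : Fin 3 → MvPolynomial (Fin 3) F := MvPolynomial.X with hX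
  have hB : X 1 ≠ 0 := MvPolynomial.X_ne_zero 1
  have hHA : X 2 + X 0 ≠ 0 := fun h => by
    have := congrArg (MvPolynomial.eval ![(1 : F), 0, 0]) h
    simp [hX] at this
  have hABH : X 0 + X 1 + X 2 ≠ 0 := fun h => by
    have := congrArg (MvPolynomial.eval ![(1 : F), 0, 0]) h
    simp [hX] at this
  refine ⟨?_, ?_, ?_⟩
  · have h := sum_neg_one_pow_mul_add_pow_mul p (X 0) (X 1) (X 2)
    rw [← sum_neg_one_pow_mul_pow_mul_pow p (X 2) (X 0) hHA] at h
    simpa using congrArg χ h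
  · have h := sum_eq_sum_mul_geom_sum p (X 0) (X 1) (X 2) hB hHA hABH
    simp only [mul_comm (_ ^ _) (X 0 ^ _)] at h
    simpa using congrArg χ h
  · have h := sum_eq_sum_geom_sum_mul p (X 0) (X 1) (X 2) hB hHA hABH
    simp only [mul_right_comm _ _ (X 0 ^ _)] at h
    simpa using congrArg χ h

end CommutingOperators

/-! ### The three commuting operators on bilinear maps -/

section LieOperators

variable (F : Type*) {L M : Type*} [Field F] [LieRing L] [LieAlgebra F L]
  [AddCommGroup M] [Module F M]

/-- The operator `y ↦ ⁅y, h⁆`. -/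
def lieRight (h : L) : Module.End F L := -LieAlgebra.ad F L h

variable {F}

@[simp]
theorem lieRight_apply (h y : L) : lieRight F h y = ⁅y, h⁆ := by
  simp [lieRight]

theorem leftBracket_append (x y : L) (ys : List L) :
    leftBracket x (ys ++ [y]) = ⁅leftBracket x ys, y⁆ := by
  simp [leftBracket]

variable (F) in
theorem leftBracket_replicate (g h : L) (k : ℕ) :
    leftBracket g (List.replicate k h) = (lieRight F h ^ k) g := by
  induction k with
  | zero => rfl
  | succ k ih => rw [List.replicate_succ', leftBracket_append, ih, pow_succ', Module.End.mul_apply,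
      lieRight_apply]

variable (F M) in
/-- Precomposition of the first argument of a bilinear map with `y ↦ ⁅y, h⁆`. -/
def bracketFirst (h : L) : Module.End F (L →ₗ[F] L →ₗ[F] M) where
  toFun ψ := ψ.comp (lieRight F h)
  map_add' ψ ψ' := by ext; simp
  map_smul' c ψ := by ext; simp

variable (F M) in
/-- Precomposition of the second argument of a bilinear map with `y ↦ ⁅y, h⁆`. -/
def bracketSecond (h : L) : Module.End F (L →ₗ[F] L →ₗ[F] M) where
  toFun ψ := ψ.compl₂ (lieRight F h)
  map_add' ψ ψ' := by ext; simp
  map_smul' c ψ := by ext; simp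

variable (h : L) (ψ : L →ₗ[F] L →ₗ[F] M) (u v : L)

theorem bracketFirst_apply : bracketFirst F M h ψ u v = ψ ⁅u, h⁆ v := by simp [bracketFirst]

theorem bracketSecond_apply : bracketSecond F M h ψ u v = ψ u ⁅v, h⁆ := by simp [bracketSecond]

theorem bracketFirst_pow_apply (k : ℕ) :
    (bracketFirst F M h ^ k) ψ u v = ψ ((lieRight F h ^ k) u) v := by
  induction k generalizing u with
  | zero => rfl
  | succ k ih => rw [pow_succ', Module.End.mul_apply, bracketFirst_apply, ih, pow_succ,
      Module.End.mul_apply, lieRight_apply]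

theorem bracketSecond_pow_apply (k : ℕ) :
    (bracketSecond F M h ^ k) ψ u v = ψ u ((lieRight F h ^ k) v) := by
  induction k generalizing v with
  | zero => rfl
  | succ k ih => rw [pow_succ', Module.End.mul_apply, bracketSecond_apply, ih, pow_succ,
      Module.End.mul_apply, lieRight_apply]

theorem commute_bracketFirst_bracketSecond :
    Commute (bracketFirst F M h) (bracketSecond F M h) := by
  ext ψ u v
  simp [bracketFirst_apply, bracketSecond_apply]

/-- The bilinear map `(u, v) ↦ f ⁅u, v⁆`. -/
def evalBracket (f : L →ₗ[F] M) : L →ₗ[F] L →ₗ[F] M :=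
  LinearMap.mk₂ F (fun u v => f ⁅u, v⁆) (by simp) (by simp) (by simp) (by simp)

theorem evalBracket_apply (f : L →ₗ[F] M) : evalBracket f u v = f ⁅u, v⁆ := rfl

/-- Bracketing with `h` is a derivation, so `A + B` passes inside the bracket. -/
theorem add_pow_evalBracket_apply (f : L →ₗ[F] M) (k : ℕ) :
    ((bracketFirst F M h + bracketSecond F M h) ^ k) (evalBracket f) u v =
      f ((lieRight F h ^ k) ⁅u, v⁆) := by
  induction k generalizing u v with
  | zero => rfl
  | succ k ih =>
    rw [pow_succ', Module.End.mul_apply, LinearMap.add_apply, LinearMap.add_apply,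
      LinearMap.add_apply, bracketFirst_apply, bracketSecond_apply, ih, ih, pow_succ,
      Module.End.mul_apply, lieRight_apply, ← map_add, ← map_add]
    congr 2
    rw [lie_lie u v h, ← lie_skew ⁅u, h⁆ v]
    abel

variable (φ : twoCochain F L M)

/-- The linear map `y ↦ φ(y, h)`. -/
def evalSecond : L →ₗ[F] M := φ.1.flip h

theorem evalSecond_apply (y : L) : evalSecond h φ y = φ y h := rfl

variable [LieRingModule L M] [LieModule F L M]

theorem iterAct_append (y : L) (ys : List L) (m : M) :
    iterAct (ys ++ [y]) m = iterAct ys ⁅y, m⁆ := by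
  simp [iterAct]

variable (F) in
theorem iterAct_replicate (k : ℕ) (m : M) :
    iterAct (List.replicate k h) m = (LieModule.toEnd F L M h ^ k) m := by
  induction k with
  | zero => rfl
  | succ k ih =>
    rw [List.replicate_succ, pow_succ', Module.End.mul_apply, ← ih]
    rfl

variable (F M) in
/-- Postcomposition of a bilinear map with the action of `h`. -/
def actValue : Module.End F (L →ₗ[F] L →ₗ[F] M) where
  toFun ψ := ψ.compr₂ (LieModule.toEnd F L M h)
  map_add' ψ ψ' := by ext; simp
  map_smul' c ψ := by ext; simp

theorem actValue_apply : actValue F M h ψ u v = ⁅h, ψ u v⁆ := by simp [actValue]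

theorem actValue_pow_apply (k : ℕ) :
    (actValue F M h ^ k) ψ u v = (LieModule.toEnd F L M h ^ k) (ψ u v) := by
  induction k with
  | zero => rfl
  | succ k ih => rw [pow_succ', Module.End.mul_apply, actValue_apply, ih, pow_succ',
      Module.End.mul_apply, LieModule.toEnd_apply_apply]

theorem commute_bracketFirst_actValue :
    Commute (bracketFirst F M h) (actValue F M h) := by
  ext ψ u v
  simp [bracketFirst_apply, actValue_apply]

theorem commute_bracketSecond_actValue :
    Commute (bracketSecond F M h) (actValue F M h) := by
  ext ψ u v
  simp [bracketSecond_apply, actValue_apply]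

/-- The bilinear map `(u, v) ↦ ⁅u, f v⁆`. -/
def firstAct (f : L →ₗ[F] M) : L →ₗ[F] L →ₗ[F] M :=
  LinearMap.mk₂ F (fun u v => ⁅u, f v⁆) (by simp) (by simp) (by simp) (by simp)

theorem firstAct_apply (f : L →ₗ[F] M) : firstAct f u v = ⁅u, f v⁆ := rfl

/-- By the module axiom, `h(u m) + [u, h] m = u(h m)`: `H + A` moves past `u`. -/
theorem add_pow_firstAct_apply (f : L →ₗ[F] M) (k : ℕ) :
    ((actValue F M h + bracketFirst F M h) ^ k) (firstAct f) u v =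
      ⁅u, (LieModule.toEnd F L M h ^ k) (f v)⁆ := by
  induction k generalizing u v with
  | zero => rfl
  | succ k ih =>
    rw [pow_succ', Module.End.mul_apply, LinearMap.add_apply, LinearMap.add_apply,
      LinearMap.add_apply, bracketFirst_apply, actValue_apply, ih, ih, pow_succ',
      Module.End.mul_apply, LieModule.toEnd_apply_apply, lie_lie]
    abel

theorem add_pow_firstAct_flip_apply (f : L →ₗ[F] M) (k : ℕ) :
    ((actValue F M h + bracketSecond F M h) ^ k) (firstAct f).flip u v =
      ⁅v, (LieModule.toEnd F L M h ^ k) (f u)⁆ := by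
  induction k generalizing u v with
  | zero => rfl
  | succ k ih =>
    rw [pow_succ', Module.End.mul_apply, LinearMap.add_apply, LinearMap.add_apply,
      LinearMap.add_apply, bracketSecond_apply, actValue_apply, ih, ih, pow_succ',
      Module.End.mul_apply, LieModule.toEnd_apply_apply, lie_lie]
    abel

/-- The terms of `δφ(u, v, h)` are sorted by where `h` enters: those with `h` as an argument of `φ`
depend only on the linear map `φ(·, h)`, and the rest form `-(A + B + H)φ`. -/
theorem classicalCoboundary_eq :
    classicalCoboundary F φ ![u, v, h] =
      (evalBracket (evalSecond h φ) - firstAct (evalSecond h φ) + (firstAct (evalSecond h φ)).flip -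
        (bracketFirst F M h + bracketSecond F M h + actValue F M h) φ.1) u v := by
  simp only [classicalCoboundary, AlternatingMap.coe_mk, MultilinearMap.coe_mk,
    Matrix.cons_val_zero, Matrix.cons_val_one, Matrix.cons_val, LinearMap.sub_apply,
    LinearMap.add_apply, LinearMap.flip_apply, evalBracket_apply, firstAct_apply,
    bracketFirst_apply, bracketSecond_apply, actValue_apply, evalSecond_apply,
    twoCochain_val_apply]
  rw [← twoCochain_skew φ u ⁅v, h⁆]
  abel

theorem neg_one_pow_mul_end {N : Type*} [AddCommGroup N] [Module F N] (T : Module.End F N) (i : ℕ) :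
    (-1) ^ i * T = (-1 : F) ^ i • T := by
  rcases Nat.even_or_odd i with hi | hi <;> simp [hi.neg_one_pow]

/-- The coefficients `j.choose k` are those of the binomial expansion of `(H + A)^j`. -/
theorem sum_classicalCoboundary_eq (p : ℕ) (g x : L) :
    ∑ j ∈ Finset.range (p - 1), (-1 : F) ^ j • ∑ k ∈ Finset.range (j + 1), j.choose k •
        (LieModule.toEnd F L M h ^ k) (classicalCoboundary F φ
          ![(lieRight F h ^ (j - k)) g, (lieRight F h ^ (p - 2 - j)) x, h]) =
      (∑ j ∈ Finset.range (p - 1), (-1) ^ j * (actValue F M h + bracketFirst F M h) ^ j *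
          bracketSecond F M h ^ (p - 2 - j) : Module.End F (L →ₗ[F] L →ₗ[F] M))
        (evalBracket (evalSecond h φ) - firstAct (evalSecond h φ) +
          (firstAct (evalSecond h φ)).flip -
          (bracketFirst F M h + bracketSecond F M h + actValue F M h) φ.1) g x := by
  set Ψ := evalBracket (evalSecond h φ) - firstAct (evalSecond h φ) +
          (firstAct (evalSecond h φ)).flip -
          (bracketFirst F M h + bracketSecond F M h + actValue F M h) φ.1 with hΨ
  rw [LinearMap.sum_apply, LinearMap.sum_apply, LinearMap.sum_apply]
  refine Finset.sum_congr rfl fun j _ => ?_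
  rw [(commute_bracketFirst_actValue h).symm.add_pow, mul_assoc, neg_one_pow_mul_end (F := F),
    Finset.sum_mul, LinearMap.smul_apply, LinearMap.smul_apply, LinearMap.smul_apply,
    LinearMap.sum_apply, LinearMap.sum_apply, LinearMap.sum_apply]
  congr 1
  refine Finset.sum_congr rfl fun k _ => ?_
  rw [classicalCoboundary_eq, ← hΨ, Module.End.mul_apply, ← nsmul_eq_mul',
    LinearMap.smul_apply, LinearMap.smul_apply, LinearMap.smul_apply, Module.End.mul_apply,
    actValue_pow_apply, bracketFirst_pow_apply, bracketSecond_pow_apply]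

end LieOperators

/-! ### The derivative identity -/

section KeyIdentity

variable {F : Type*} {L M : Type*} [Field F] [LieRing L] [LieAlgebra F L]
  [AddCommGroup M] [Module F M] [LieRingModule L M] [LieModule F L M]
  (p : ℕ) (h : L)

variable (F M) in
/-- The operator `∑ (-1)ʲ (H + A)ʲ B^(p-2-j)` on bilinear maps, for the commuting operators `A`,
`B`, `H` of bracketing the first argument, the second argument, and acting on the value. -/
def alternatingOperator : Module.End F (L →ₗ[F] L →ₗ[F] M) :=
  ∑ j ∈ Finset.range (p - 1), (-1) ^ j * (actValue F M h + bracketFirst F M h) ^ j *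
    bracketSecond F M h ^ (p - 2 - j)

theorem alternatingOperator_firstAct (f : L →ₗ[F] M) (g x : L) :
    alternatingOperator F M p h (firstAct f) g x =
      ⁅g, ∑ j ∈ Finset.range (p - 1), (-1 : F) ^ j • (LieModule.toEnd F L M h ^ j)
        (f ((lieRight F h ^ (p - 2 - j)) x))⁆ := by
  have hc : ∀ j k : ℕ, Commute ((actValue F M h + bracketFirst F M h) ^ j)
      (bracketSecond F M h ^ k) := fun j k =>
    (((commute_bracketSecond_actValue h).add_right
      (commute_bracketFirst_bracketSecond h).symm).pow_pow k j).symm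
  rw [alternatingOperator, lie_sum, LinearMap.sum_apply, LinearMap.sum_apply,
    LinearMap.sum_apply]
  refine Finset.sum_congr rfl fun j _ => ?_
  rw [mul_assoc, (hc _ _).eq, neg_one_pow_mul_end (F := F), LinearMap.smul_apply,
    LinearMap.smul_apply, LinearMap.smul_apply, Module.End.mul_apply, bracketSecond_pow_apply,
    add_pow_firstAct_apply, lie_smul]

variable [Fact p.Prime] [CharP F p]

theorem alternatingOperator_evalBracket (f : L →ₗ[F] M) (g x : L) :
    alternatingOperator F M p h (evalBracket f) g x =
      ∑ i ∈ Finset.range p, (-1 : F) ^ i • (LieModule.toEnd F L M h ^ i)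
        (∑ c ∈ Finset.range (p - 1 - i),
          f ((lieRight F h ^ (p - 2 - i - c)) ⁅(lieRight F h ^ c) g, x⁆)) := by
  rw [alternatingOperator,
    (commute_sum_identities (E := Module.End F (L →ₗ[F] L →ₗ[F] M)) F p
    (commute_bracketFirst_bracketSecond (F := F) (M := M) h)
    (commute_bracketFirst_actValue (F := F) (M := M) h)
    (commute_bracketSecond_actValue (F := F) (M := M) h)).2.1]
  simp only [LinearMap.sum_apply, neg_one_pow_mul_end (F := F), LinearMap.smul_apply,
    Module.End.mul_apply, actValue_pow_apply, bracketFirst_pow_apply, add_pow_evalBracket_apply]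

theorem alternatingOperator_firstAct_flip (f : L →ₗ[F] M) (g x : L) :
    alternatingOperator F M p h (firstAct f).flip g x =
      ∑ i ∈ Finset.range p, (-1 : F) ^ i • ∑ a ∈ Finset.range i, (LieModule.toEnd F L M h ^ a)
        ⁅x, (LieModule.toEnd F L M h ^ (i - 1 - a)) (f ((lieRight F h ^ (p - 1 - i)) g))⁆ := by
  rw [alternatingOperator,
    (commute_sum_identities (E := Module.End F (L →ₗ[F] L →ₗ[F] M)) F p
    (commute_bracketFirst_bracketSecond (F := F) (M := M) h)
    (commute_bracketFirst_actValue (F := F) (M := M) h)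
    (commute_bracketSecond_actValue (F := F) (M := M) h)).2.2]
  simp only [LinearMap.sum_apply, neg_one_pow_mul_end (F := F), LinearMap.smul_apply,
    Module.End.mul_apply, actValue_pow_apply, bracketFirst_pow_apply,
    add_pow_firstAct_flip_apply]

theorem alternatingOperator_add_apply (ψ : L →ₗ[F] L →ₗ[F] M) (g x : L) :
    alternatingOperator F M p h
        ((bracketFirst F M h + bracketSecond F M h + actValue F M h) ψ) g x =
      ψ g ((lieRight F h ^ (p - 1)) x) - ∑ i ∈ Finset.range p, (-1 : F) ^ i •
        (LieModule.toEnd F L M h ^ i) (ψ ((lieRight F h ^ (p - 1 - i)) g) x) := by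
  rw [← Module.End.mul_apply, alternatingOperator,
    (commute_sum_identities (E := Module.End F (L →ₗ[F] L →ₗ[F] M)) F p
    (commute_bracketFirst_bracketSecond (F := F) (M := M) h)
    (commute_bracketFirst_actValue (F := F) (M := M) h)
    (commute_bracketSecond_actValue (F := F) (M := M) h)).1]
  simp only [LinearMap.sub_apply, LinearMap.sum_apply, neg_one_pow_mul_end (F := F),
    LinearMap.smul_apply, Module.End.mul_apply, actValue_pow_apply, bracketFirst_pow_apply,
    bracketSecond_pow_apply]

/-- The first two terms on the left cancel the `B^(p-1)` part of `T(A+B+H)φ` and the `firstAct`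
part. What survives is the three kinds of terms obtained by placing `x` in the bracket, in the last
slot of `φ`, or among the acting letters. -/
theorem sum_classicalCoboundary_add (φ : twoCochain F L M) (g x : L) :
    φ g ((lieRight F h ^ (p - 1)) x) +
      ⁅g, ∑ j ∈ Finset.range (p - 1), (-1 : F) ^ j • (LieModule.toEnd F L M h ^ j)
        (φ ((lieRight F h ^ (p - 2 - j)) x) h)⁆ +
      ∑ j ∈ Finset.range (p - 1), (-1 : F) ^ j • ∑ k ∈ Finset.range (j + 1), j.choose k •
        (LieModule.toEnd F L M h ^ k) (classicalCoboundary F φ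
          ![(lieRight F h ^ (j - k)) g, (lieRight F h ^ (p - 2 - j)) x, h]) =
      ∑ i ∈ Finset.range p, (-1 : F) ^ i •
        ((LieModule.toEnd F L M h ^ i)
            (∑ c ∈ Finset.range (p - 1 - i),
                φ ((lieRight F h ^ (p - 2 - i - c)) ⁅(lieRight F h ^ c) g, x⁆) h +
              φ ((lieRight F h ^ (p - 1 - i)) g) x) +
          ∑ a ∈ Finset.range i, (LieModule.toEnd F L M h ^ a)
            ⁅x, (LieModule.toEnd F L M h ^ (i - 1 - a)) (φ ((lieRight F h ^ (p - 1 - i)) g) h)⁆) := by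
  have h1 := alternatingOperator_evalBracket p h (evalSecond h φ) g x
  have h2 := alternatingOperator_firstAct_flip p h (evalSecond h φ) g x
  have h3 := alternatingOperator_firstAct p h (evalSecond h φ) g x
  have h4 := alternatingOperator_add_apply p h φ.1 g x
  simp only [evalSecond_apply, twoCochain_val_apply] at h1 h2 h3 h4
  rw [sum_classicalCoboundary_eq, ← alternatingOperator, map_sub, map_add, map_sub,
    LinearMap.sub_apply, LinearMap.sub_apply, LinearMap.add_apply, LinearMap.add_apply,
    LinearMap.sub_apply, LinearMap.sub_apply, h1, h2, h3, h4]
  simp only [smul_add, map_add, Finset.sum_add_distrib]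
  abel

end KeyIdentity

/-! ### The multilinear maps `wordSum` and `wordDefect` -/

section WordMaps

variable {F : Type*} {L M : Type*} [Field F] [LieRing L] [LieAlgebra F L]
  [AddCommGroup M] [Module F M]

theorem MultilinearOn.twoCochain {I J K : Finset ℕ} {f₁ f₂ : (ℕ → L) → L}
    (h₁ : MultilinearOn F I f₁) (h₂ : MultilinearOn F J f₂) (φ : twoCochain F L M)
    (hIJ : Disjoint I J) (hK : K = I ∪ J) : MultilinearOn F K fun s => φ (f₁ s) (f₂ s) := by
  subst hK
  exact h₁.bilin φ.1 h₂ hIJ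

variable [LieRingModule L M] [LieModule F L M]

theorem MultilinearOn.lie {I J K : Finset ℕ} {f₁ : (ℕ → L) → L} {f₂ : (ℕ → L) → M}
    (h₁ : MultilinearOn F I f₁) (h₂ : MultilinearOn F J f₂) (hIJ : Disjoint I J)
    (hK : K = I ∪ J) : MultilinearOn F K fun s => ⁅f₁ s, f₂ s⁆ := by
  subst hK
  exact h₁.bilin (LieModule.toEnd F L M : L →ₗ[F] Module.End F M) h₂ hIJ

theorem polarDeriv_lie {I J K : Finset ℕ} {f₁ : (ℕ → L) → L} {f₂ : (ℕ → L) → M}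
    (h₁ : MultilinearOn F I f₁) (h₂ : MultilinearOn F J f₂) (hIJ : Disjoint I J)
    (hK : K = I ∪ J) (h x : L) : polarDeriv K (fun s => ⁅f₁ s, f₂ s⁆) h x =
      ⁅polarDeriv I f₁ h x, f₂ fun _ => h⁆ + ⁅f₁ fun _ => h, polarDeriv J f₂ h x⁆ := by
  subst hK
  exact h₁.polarDeriv_bilin (LieModule.toEnd F L M : L →ₗ[F] Module.End F M) h₂ hIJ h x

theorem polarDeriv_eval {V : Type*} [AddCommGroup V] (n : ℕ) (h x : V) :
    polarDeriv {n} (fun s => s n) h x = x := by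
  simp [polarDeriv]

theorem multilinearOn_leftBracket (g : L) (k : ℕ) :
    MultilinearOn F (Finset.Icc 1 k)
      fun s : ℕ → L => leftBracket g ((List.range k).map fun n => s (n + 1)) := by
  induction k with
  | zero => exact MultilinearOn.const g
  | succ k ih =>
    simp only [List.range_succ, List.map_append, List.map_cons, List.map_nil, leftBracket_append]
    refine ih.lie (.eval (k + 1)) (by simp) ?_
    ext n; simp; omega

theorem polarDeriv_leftBracket (g : L) (k : ℕ) (h x : L) :
    polarDeriv (Finset.Icc 1 k) (fun s => leftBracket g ((List.range k).map fun n => s (n + 1)))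
      h x = ∑ c ∈ Finset.range k, (lieRight F h ^ (k - 1 - c)) ⁅(lieRight F h ^ c) g, x⁆ := by
  induction k with
  | zero => rfl
  | succ k ih =>
    simp only [List.range_succ, List.map_append, List.map_cons, List.map_nil, leftBracket_append]
    rw [polarDeriv_lie (multilinearOn_leftBracket (F := F) g k) (.eval (k + 1)) (by simp)
      (by ext n; simp; omega), ih, polarDeriv_eval, Finset.sum_range_succ, sum_lie]
    congr 1
    · refine Finset.sum_congr rfl fun c hc => ?_
      have := Finset.mem_range.1 hc
      rw [← lieRight_apply (F := F), ← Module.End.mul_apply, ← pow_succ']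
      congr 2
      omega
    · rw [List.map_const', List.length_range, leftBracket_replicate F]
      simp

theorem multilinearOn_leftBracket_sub (g : L) {m k : ℕ} (hk : k ≤ m) :
    MultilinearOn F (Finset.Ioc (m - k) m)
      fun s : ℕ → L => leftBracket g ((List.range k).map fun n => s (m - n)) := by
  induction k with
  | zero => simpa [leftBracket] using MultilinearOn.const g
  | succ k ih =>
    simp only [List.range_succ, List.map_append, List.map_cons, List.map_nil, leftBracket_append]
    refine (ih (by omega)).lie (.eval (m - k)) (by simp) ?_
    ext n; simp; omega

theorem multilinearOn_initialBracket {n : ℕ} (hn : 1 ≤ n) :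
    MultilinearOn F (Finset.Icc 1 n) fun s : ℕ → L => initialBracket s n := by
  obtain ⟨k, rfl⟩ : ∃ k, n = k + 1 := ⟨n - 1, by omega⟩
  simp only [initialBracket, Nat.add_sub_cancel]
  clear hn
  induction k with
  | zero => simpa [leftBracket] using MultilinearOn.eval (F := F) (V := L) 1
  | succ k ih =>
    simp only [List.range_succ, List.map_append, List.map_cons, List.map_nil, leftBracket_append]
    refine ih.lie (.eval (k + 2)) (by simp) ?_
    ext n; simp; omega

theorem multilinearOn_iterAct {m k : ℕ} (hk : k ≤ m) {f : (ℕ → L) → M}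
    (hf : MultilinearOn F (Finset.Icc 1 (m - k)) f) :
    MultilinearOn F (Finset.Icc 1 m)
      fun s : ℕ → L => iterAct ((List.range k).map fun n => s (m - n)) (f s) := by
  induction k generalizing f with
  | zero => exact hf
  | succ k ih =>
    simp only [List.range_succ, List.map_append, List.map_cons, List.map_nil, iterAct_append]
    refine ih (by omega) ((MultilinearOn.eval (m - k)).lie hf ?_ ?_)
    · simp; omega
    · ext n; simp; omega

/-- Leibniz rule: `x` replaces a letter of the inner map or one of the `k` acting letters, with `a`
letters standing to its left. -/
theorem polarDeriv_iterAct {m k : ℕ} (hk : k ≤ m) {f : (ℕ → L) → M}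
    (hf : MultilinearOn F (Finset.Icc 1 (m - k)) f) (h x : L) :
    polarDeriv (Finset.Icc 1 m)
        (fun s : ℕ → L => iterAct ((List.range k).map fun n => s (m - n)) (f s)) h x =
      (LieModule.toEnd F L M h ^ k) (polarDeriv (Finset.Icc 1 (m - k)) f h x) +
        ∑ a ∈ Finset.range k, (LieModule.toEnd F L M h ^ a)
          ⁅x, (LieModule.toEnd F L M h ^ (k - 1 - a)) (f fun _ => h)⁆ := by
  induction k generalizing f with
  | zero => simp [iterAct]
  | succ k ih =>
    simp only [List.range_succ, List.map_append, List.map_cons, List.map_nil, iterAct_append]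
    have hd : Disjoint {m - k} (Finset.Icc 1 (m - (k + 1))) := by simp; omega
    have hu : Finset.Icc 1 (m - k) = {m - k} ∪ Finset.Icc 1 (m - (k + 1)) := by
      ext n; simp; omega
    rw [ih (by omega) ((MultilinearOn.eval (m - k)).lie hf hd hu),
      polarDeriv_lie (.eval (m - k)) hf hd hu, polarDeriv_eval, Finset.sum_range_succ, pow_succ,
      Module.End.mul_apply, LieModule.toEnd_apply_apply, map_add]
    have : ∀ a ∈ Finset.range k, (LieModule.toEnd F L M h ^ a)
        ⁅x, (LieModule.toEnd F L M h ^ (k - 1 - a)) ⁅h, f fun _ => h⁆⁆ =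
        (LieModule.toEnd F L M h ^ a)
          ⁅x, (LieModule.toEnd F L M h ^ (k + 1 - 1 - a)) (f fun _ => h)⁆ := by
      intro a ha
      have := Finset.mem_range.1 ha
      rw [show k + 1 - 1 - a = k - 1 - a + 1 by omega, pow_succ, Module.End.mul_apply,
        LieModule.toEnd_apply_apply]
    rw [Finset.sum_congr rfl this, Nat.add_sub_cancel, Nat.sub_self, pow_zero,
      Module.End.one_apply]
    abel

theorem map_range_update {V : Type*} {h x : V} {m k : ℕ} (hk : k < m) :
    ((List.range k).map fun n => Function.update (fun _ => h) 1 x (m - n)) =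
      List.replicate k h := by
  rw [List.map_congr_left (g := fun _ => h), List.map_const', List.length_range]
  intro n hn
  have := List.mem_range.1 hn
  exact Function.update_of_ne (by omega) _ _

omit [LieRingModule L M] [LieModule F L M] in
theorem multilinearOn_twoCochain_leftBracket (p : ℕ) (φ : twoCochain F L M) (g : L) {i : ℕ}
    (hi : i < p) :
    MultilinearOn F (Finset.Icc 1 (p - i)) fun s : ℕ → L =>
      φ (leftBracket g ((List.range (p - 1 - i)).map fun n => s (n + 1))) (s (p - i)) := by
  refine (multilinearOn_leftBracket g (p - 1 - i)).twoCochain (.eval (p - i)) φ ?_ ?_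
  · simp; omega
  · ext n; simp; omega

variable (F) (p : ℕ) (φ : twoCochain F L M) (g : L)

/-- The multilinear map `∑ (-1)ⁱ s_p ⋯ s_{p-i+1} φ([g, s_1, …, s_{p-1-i}], s_{p-i})`. -/
def wordSum (s : ℕ → L) : M :=
  ∑ i ∈ Finset.range p, (-1 : F) ^ i • iterAct ((List.range i).map fun n => s (p - n))
    (φ (leftBracket g ((List.range (p - 1 - i)).map fun n => s (n + 1))) (s (p - i)))

/-- The summand, for the word `s`, of the deviation of `inducedMap` from additivity in its second
argument. -/
def wordDefect (s : ℕ → L) : M :=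
  φ g (initialBracket s p) +
    ⁅g, ∑ k ∈ Finset.range (p - 1), (-1 : F) ^ k •
      iterAct ((List.range k).map fun i => s (p - i))
        (φ (initialBracket s (p - k - 1)) (s (p - k)))⁆ +
    ∑ j ∈ Finset.range (p - 1), (-1 : F) ^ j •
      ∑ k ∈ Finset.range (j + 1), (j.choose k) •
        iterAct ((List.range k).map fun i => s (p - i))
          (classicalCoboundary F φ ![leftBracket g ((List.range (j - k)).map fun i => s (p - k - i)),
            initialBracket s (p - j - 1), s (p - j)])

theorem multilinearOn_wordSum : MultilinearOn F (Finset.Icc 1 p) (wordSum F p φ g) := by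
  refine .sum _ _ fun i hi => .const_smul _ (multilinearOn_iterAct
    (Finset.mem_range.1 hi).le (multilinearOn_twoCochain_leftBracket p φ g (Finset.mem_range.1 hi)))

theorem polarDeriv_wordSum (h x : L) : polarDeriv (Finset.Icc 1 p) (wordSum F p φ g) h x =
      ∑ i ∈ Finset.range p, (-1 : F) ^ i •
        ((LieModule.toEnd F L M h ^ i)
            (∑ c ∈ Finset.range (p - 1 - i),
                φ ((lieRight F h ^ (p - 2 - i - c)) ⁅(lieRight F h ^ c) g, x⁆) h +
              φ ((lieRight F h ^ (p - 1 - i)) g) x) +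
          ∑ a ∈ Finset.range i, (LieModule.toEnd F L M h ^ a)
            ⁅x, (LieModule.toEnd F L M h ^ (i - 1 - a))
              (φ ((lieRight F h ^ (p - 1 - i)) g) h)⁆) := by
  unfold wordSum
  simp only [polarDeriv]
  rw [Finset.sum_comm]
  refine Finset.sum_congr rfl fun i hi => ?_
  have hi' := Finset.mem_range.1 hi
  rw [← Finset.smul_sum]
  congr 1
  refine (polarDeriv_iterAct hi'.le (multilinearOn_twoCochain_leftBracket p φ g hi') h x).trans ?_
  have hu : Finset.Icc 1 (p - i) = Finset.Icc 1 (p - 1 - i) ∪ {p - i} := by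
    ext n; simp; omega
  have hd : Disjoint (Finset.Icc 1 (p - 1 - i)) {p - i} := by simp; omega
  have hD := (multilinearOn_leftBracket (F := F) g (p - 1 - i)).polarDeriv_bilin φ.1
    (.eval (p - i)) hd h x
  simp only [twoCochain_val_apply] at hD
  rw [hu, hD, polarDeriv_eval, polarDeriv_leftBracket (F := F), map_sum, LinearMap.sum_apply,
    List.map_const', List.length_range, leftBracket_replicate F,
    show p - 1 - i - 1 = p - 2 - i by omega]

theorem multilinearOn_wordDefect (hp : 2 ≤ p) :
    MultilinearOn F (Finset.Icc 1 p) (wordDefect F p φ g) := by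
  refine ((MultilinearOn.linearMap (φ.1 g) (multilinearOn_initialBracket (by omega))).add
    (.linearMap (LieModule.toEnd F L M g) (.sum _ _ fun k hk => .const_smul _
      (multilinearOn_iterAct (by have := Finset.mem_range.1 hk; omega) ?_)))).add
    (.sum _ _ fun j hj => .const_smul _ (.sum _ _ fun k hk => .const_nsmul _
      (multilinearOn_iterAct (by
        have := Finset.mem_range.1 hk; have := Finset.mem_range.1 hj; omega) ?_)))
  · have hk' := Finset.mem_range.1 hk
    refine (multilinearOn_initialBracket (by omega)).twoCochain (.eval (p - k)) φ ?_ ?_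
    · simp; omega
    · ext n; simp; omega
  · have hj' := Finset.mem_range.1 hj
    have hk' := Finset.mem_range.1 hk
    -- The three arguments use the disjoint blocks `(p-j, p-k]`, `[1, p-j-1]` and `{p-j}`.
    -- Trilinearity comes from two bilinear steps, the second evaluating a linear map at the last
    -- letter.
    have h1 := (multilinearOn_leftBracket_sub (F := F) g (m := p - k) (k := j - k)
      (by omega)).bilin (-d₂₃ F L M φ)
      (multilinearOn_initialBracket (n := p - j - 1) (by omega)) (by
        rw [Finset.disjoint_left]; intro n; simp; omega)
    have h2 := h1.bilin LinearMap.id (.eval (p - j)) (by simp; omega)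
    simp only [classicalCoboundary_apply]
    convert h2 using 1
    · ext n; simp; omega
    · rfl

theorem initialBracket_eq_zero {s : ℕ → L} (hs : s 1 = s 2) {n : ℕ} (hn : 2 ≤ n) :
    initialBracket s n = 0 := by
  obtain ⟨k, rfl⟩ : ∃ k, n = k + 2 := ⟨n - 2, by omega⟩
  rw [initialBracket, show k + 2 - 1 = k + 1 by omega]
  clear hn
  induction k with
  | zero => simp [leftBracket, hs]
  | succ k ih => rw [List.range_succ, List.map_append, List.map_cons, List.map_nil,
      leftBracket_append, ih, zero_lie]

/-- Initial brackets of length at least two contain `[s 1, s 2] = 0`. For length one the bracket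
equals the next letter, and alternation kills the term. -/
theorem wordDefect_eq_zero (hp : 2 ≤ p) (s : ℕ → L) (hs : s 1 = s 2) :
    wordDefect F p φ g s = 0 := by
  rw [wordDefect, initialBracket_eq_zero hs hp, map_zero, zero_add]
  have e : ∀ k ∈ Finset.range (p - 1),
      initialBracket s (p - k - 1) = 0 ∨ initialBracket s (p - k - 1) = s (p - k) := by
    intro k hk
    have hk' := Finset.mem_range.1 hk
    rcases Nat.lt_or_ge k (p - 2) with h | h
    · exact .inl (initialBracket_eq_zero hs (by omega))
    · rw [show p - k - 1 = 1 by omega, show p - k = 2 by omega]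
      exact .inr (by simpa [initialBracket, leftBracket] using hs)
  rw [Finset.sum_eq_zero, Finset.sum_eq_zero, lie_zero, add_zero]
  · intro j hj
    rw [Finset.sum_eq_zero, smul_zero]
    intro k _
    have : classicalCoboundary F φ ![leftBracket g ((List.range (j - k)).map fun i => s (p - k - i)),
        initialBracket s (p - j - 1), s (p - j)] = 0 := by
      rcases e j hj with h | h
      · exact AlternatingMap.map_coord_zero _ (1 : Fin 3) (by simpa using h)
      · exact AlternatingMap.map_eq_zero_of_eq _ _ (i := 1) (j := 2) (by simpa using h) (by decide)
    rw [this, iterAct_zero, smul_zero]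
  · intro k hk
    rcases e k hk with h | h <;> simp [h, iterAct_zero]

theorem initialBracket_update (h x : L) (n : ℕ) :
    initialBracket (Function.update (fun _ => h) 1 x) n = (lieRight F h ^ (n - 1)) x := by
  rw [initialBracket, ← leftBracket_replicate F]
  simp [List.map_const']

theorem wordDefect_update [Fact p.Prime] [CharP F p] (h x : L) :
    wordDefect F p φ g (Function.update (fun _ => h) 1 x) =
      polarDeriv (Finset.Icc 1 p) (wordSum F p φ g) h x := by
  rw [polarDeriv_wordSum, ← sum_classicalCoboundary_add, wordDefect, initialBracket_update F]
  congr 1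
  · congr 2
    refine Finset.sum_congr rfl fun k hk => ?_
    have hk' := Finset.mem_range.1 hk
    rw [map_range_update (by omega), iterAct_replicate F, initialBracket_update F,
      Function.update_of_ne (by omega), show p - k - 1 - 1 = p - 2 - k by omega]
  · refine Finset.sum_congr rfl fun j hj => ?_
    have hj' := Finset.mem_range.1 hj
    congr 1
    refine Finset.sum_congr rfl fun k hk => ?_
    have hk' := Finset.mem_range.1 hk
    rw [map_range_update (by omega), map_range_update (by omega), iterAct_replicate F,
      leftBracket_replicate F, initialBracket_update F,
      Function.update_of_ne (by omega), show p - j - 1 - 1 = p - 2 - j by omega]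

omit [LieModule F L M] in
theorem wordSum_const (h : L) : wordSum F p φ g (fun _ => h) =
    ∑ i ∈ Finset.range p, (-1 : F) ^ i •
      iterAct (List.replicate i h) (φ (leftBracket g (List.replicate (p - 1 - i) h)) h) := by
  simp [wordSum, List.map_const']

theorem sum_wordDefect [RestrictedLieAlgebra F p L] (h₁ h₂ : L) :
    ∑ S ∈ markedWords p, (S.card : F)⁻¹ • wordDefect F p φ g (wordSeq h₁ h₂ S) =
      φ g (∑ S ∈ markedWords p, (S.card : F)⁻¹ • initialBracket (wordSeq h₁ h₂ S) p) +
        ⁅g, starCorrection F p φ h₁ h₂⁆ +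
        starStarCorrection F p (classicalCoboundary F φ) g h₁ h₂ := by
  simp only [wordDefect, smul_add, Finset.sum_add_distrib, starCorrection, starStarCorrection,
    map_sum, map_smul, lie_sum (ι := Finset ℕ), lie_smul]

end WordMaps

/-! ### The `**`-property -/

section InducedMap

variable {F : Type*} {L M : Type*} [Field F] [LieRing L] [LieAlgebra F L]
  [AddCommGroup M] [Module F M] [LieRingModule L M] [LieModule F L M]

theorem inducedMap_hasStarStarProperty (p : ℕ) [Fact p.Prime] [CharP F p]
    [RestrictedLieAlgebra F p L] {φ : twoCochain F L M} {ω : L → M}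
    (hω : HasStarProperty F p φ ω) :
    HasStarStarProperty F p (classicalCoboundary F φ) (inducedMap F p φ ω) where
  isLinearMap_left h := by
    constructor
    · intro g g'
      simp only [inducedMap, leftBracket_replicate F, iterAct_replicate F, map_add,
        LinearMap.add_apply, smul_add, Finset.sum_add_distrib, add_lie]
      abel
    · intro c g
      simp only [inducedMap, leftBracket_replicate F, iterAct_replicate F, map_smul,
        LinearMap.smul_apply, smul_add, smul_sub, Finset.smul_sum, smul_lie]
      simp only [smul_comm c]
  map_smul_right c g h := by
    have hR : lieRight F (c • h) = c • lieRight F h := by ext; simp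
    simp only [inducedMap, leftBracket_replicate F, iterAct_replicate F,
      RestrictedLieAlgebra.pOp_smul, hω.map_smul, hR, map_smul, smul_pow, LinearMap.smul_apply,
      lie_smul, smul_add, smul_sub, Finset.smul_sum]
    congr 2
    refine Finset.sum_congr rfl fun i hi => ?_
    have hi' := Finset.mem_range.1 hi
    rw [smul_smul, smul_smul, smul_smul, smul_smul]
    congr 1
    -- Degree count in `h`: `i` acting letters, `d` in the bracket, one in the second slot of `φ`.
    obtain ⟨d, rfl⟩ : ∃ d, p = i + d + 1 := ⟨p - 1 - i, by omega⟩
    rw [show i + d + 1 - 1 - i = d by omega]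
    ring
  map_add_right g h₁ h₂ := by
    have hp : 2 ≤ p := (Fact.out : p.Prime).two_le
    have key := map_add_of_polarDeriv_eq F p (multilinearOn_wordDefect F p φ g hp)
      (multilinearOn_wordSum F p φ g) (wordDefect_update F p φ g)
      (wordDefect_eq_zero F p φ g hp) h₁ h₂
    -- The weighted sum splits into the failures of additivity of `φ(g, h^[p])` and `g ω(h)` plus
    -- the `**`-correction. Since `wordSum` enters `β` with a minus sign, the first two cancel and
    -- the third is subtracted.
    rw [sum_wordDefect] at key
    simp only [inducedMap, ← wordSum_const]
    rw [key, RestrictedLieAlgebra.pOp_add (F := F), hω.map_add, map_add, map_add, lie_add, lie_add]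
    abel

end InducedMap

theorem mainTheorem9 {F L M : Type*} (p : ℕ) [Fact p.Prime] [Field F] [CharP F p]
    [LieRing L] [LieAlgebra F L] [RestrictedLieAlgebra F p L]
    [AddCommGroup M] [Module F M] [LieRingModule L M] [LieModule F L M]
    [IsRestrictedModule F p L M]
    (φ : LieModule.Cohomology.twoCochain F L M) (ω : L → M)
    (hφω : (φ, ω) ∈ restrictedTwoCochain F p L M) :
    HasStarStarProperty F p (classicalCoboundary F φ) (inducedMap F p φ ω) ∧
      (classicalCoboundary F φ, inducedMap F p φ ω) ∈ restrictedThreeCochain F p L M := by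
  have h := inducedMap_hasStarStarProperty p (F := F) hφω
  exact ⟨h, h⟩
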